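/- **Theorem 5 (Lonely Walkers).** There is an absolute constant $c>0$ such that for every $\varepsilon>0$ there is $N$ such that the following holds for all $n\ge N$. Let $G$ be a simple $d$-regular graph on $n$ vertices with $d\ge 1$ (any such $d$, possibly depending on $n$; $G$ need not be connected). Consider $n$ independent simple random walks on $G$, each starting from a uniformly random vertex (the stationary distribution), and run the system for $T=\lfloor 0.1\,n\log n\rfloor$ time steps, where in each time step exactly one walk, chosen uniformly at random among the $n$ walks and independently of everything else, makes one step, i.e. moves to a uniformly random neighbour of its current vertex. Then with probability at least $1-\varepsilon$ there are at least $c\,n^{3/4}$ walks that never meet any other walk, i.e. that at none of the times $0,1,\dots,T$ are at the same vertex as another walk. -/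

import Mathlib

open MeasureTheory ProbabilityTheory
open scoped ENNReal

namespace LonelyWalkers

/-- Transition probability of simple random walk on `G`: from `x`, move to a uniformly random
neighbour of `x`. -/
noncomputable def stepProb {V : Type*} [Fintype V] (G : SimpleGraph V) [DecidableRel G.Adj]
    (x y : V) : ℝ≥0∞ :=
  if G.Adj x y then (G.degree x : ℝ≥0∞)⁻¹ else 0

/-- Law of the trajectory `p 0, p 1, …, p T` of `T` steps of simple random walk on `G` whose
starting vertex `p 0` is uniformly distributed (on a regular graph this is a stationary start). -/
noncomputable def walkLaw {V : Type*} [Fintype V] [MeasurableSpace V]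
    (G : SimpleGraph V) [DecidableRel G.Adj] (T : ℕ) : Measure (Fin (T + 1) → V) :=
  ∑ p : Fin (T + 1) → V,
    ((Fintype.card V : ℝ≥0∞)⁻¹ * ∏ s : Fin T, stepProb G (p s.castSucc) (p s.succ)) •
      Measure.dirac p

/-- A realisation of a system of `n` walks run for `T` time steps. -/
abbrev Outcome (V : Type*) (n T : ℕ) : Type _ :=
  -- the trajectory of each walk, and the walk that moves in each time step
  (Fin n → Fin (T + 1) → V) × (Fin T → Fin n)

/-- Law of the system: the `n` trajectories are independent random walks started from
stationarity, and, independently of them, the walks that move in time steps `1, …, T` are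
independent and uniformly random. -/
noncomputable def systemLaw {V : Type*} [Fintype V] [MeasurableSpace V]
    (G : SimpleGraph V) [DecidableRel G.Adj] (n T : ℕ) : Measure (Outcome V n T) :=
  (Measure.pi fun _ : Fin n => walkLaw G T).prod
    (Measure.pi fun _ : Fin T => uniformOn (Set.univ : Set (Fin n)))

/-- Number of moves that walk `i` makes in the first `t` time steps. -/
def moves {n T : ℕ} (mover : Fin T → Fin n) (i : Fin n) (t : ℕ) : ℕ :=
  (Finset.univ.filter fun s : Fin T => (s : ℕ) < t ∧ mover s = i).card

theorem moves_lt {n T : ℕ} (mover : Fin T → Fin n) (i : Fin n) (t : ℕ) :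
    moves mover i t < T + 1 :=
  Nat.lt_succ_of_le ((Finset.card_le_univ _).trans_eq (Fintype.card_fin T))

/-- Vertex occupied by walk `i` after `t` time steps. -/
def position {V : Type*} {n T : ℕ} (ω : Outcome V n T) (i : Fin n) (t : ℕ) : V :=
  ω.1 i ⟨moves ω.2 i t, moves_lt ω.2 i t⟩

/-- Walk `i` never meets another walk: at no time `0, 1, …, T` does it share its vertex with
another walk. -/
def IsLonely {V : Type*} {n T : ℕ} (ω : Outcome V n T) (i : Fin n) : Prop :=
  ∀ j : Fin n, j ≠ i → ∀ t : ℕ, t ≤ T → position ω j t ≠ position ω i t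

end LonelyWalkers

/-! It is enough to count the walks that never move and whose starting vertex is on no other walk's
path. Fix the schedule, so that walk `j` makes `m j` moves with sum `T`. By stationarity, walk `j`
avoids a given vertex with probability at least `1 - (m j + 1) / n`. By independence, a resting walk
is unmet with probability at least the product over `j`, which is at least `exp (-(10/9) (T + n) /
n)`, of order `n ^ (-1/9)` (`le_integral_card_unmet`). The expected number of resting walks is at
least `n ^ (8/9)`, so about `n ^ (7/9)` unmet walks are expected, and `7/9 > 3/4`.

Both counts concentrate by bounded differences and Chebyshev (`variance_pi_le`,
`measureReal_lt_half_le`). Reassigning one time step changes the number of resting walks by at most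
1; replacing the path of walk `j` changes the number of unmet walks by at most `m j + 2`. The
variance bound `∑ (m j + 2) ^ 2` is below `n ^ (6/5)` for most schedules, by Markov, far below the
squared mean `n ^ (14/9)`. -/

namespace LonelyWalkers

/-! ### Variance bounds under product measures -/

section BoundedDifferences

variable {α β : Type*} [Finite α] [MeasurableSpace α] [MeasurableSingletonClass α]
  [Finite β] [MeasurableSpace β] [MeasurableSingletonClass β]

lemma memLp_two_of_finite (μ : Measure α) [IsFiniteMeasure μ] (f : α → ℝ) : MemLp f 2 μ :=
  (memLp_two_iff_integrable_sq (measurable_of_finite f).aestronglyMeasurable).2 .of_finite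

/-- A function whose values differ by at most `c` has variance at most `c ^ 2`. -/
lemma variance_le_sq_of_abs_sub_le (μ : Measure α) [IsProbabilityMeasure μ] (f : α → ℝ) (c : ℝ)
    (h : ∀ x y, |f x - f y| ≤ c) : Var[f; μ] ≤ c ^ 2 := by
  obtain ⟨x₀⟩ := nonempty_of_isProbabilityMeasure μ
  have := variance_le_sq_of_bounded (μ := μ) (a := f x₀ - c) (b := f x₀ + c) (X := f)
    (Filter.Eventually.of_forall fun x => by
      have := abs_le.1 (h x x₀)
      constructor <;> linarith) (measurable_of_finite f).aemeasurable
  convert this using 1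
  ring

/-- Law of total variance: for each fixed `y` the conditional variance is at most `c ^ 2`. -/
lemma variance_prod_le (μ : Measure α) [IsProbabilityMeasure μ] (ν : Measure β)
    [IsProbabilityMeasure ν] (f : α × β → ℝ) (c : ℝ)
    (h : ∀ x x' y, |f (x, y) - f (x', y)| ≤ c) :
    Var[f; μ.prod ν] ≤ c ^ 2 + Var[fun y => ∫ x, f (x, y) ∂μ; ν] := by
  rw [variance_eq_sub (memLp_two_of_finite _ _), variance_eq_sub (memLp_two_of_finite _ _),
    integral_prod_symm _ .of_finite, integral_prod_symm _ .of_finite]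
  have key : ∫ y, ∫ x, (f ^ 2) (x, y) ∂μ ∂ν ≤
      ∫ y, (c ^ 2 + ((fun y => ∫ x, f (x, y) ∂μ) ^ 2) y) ∂ν := by
    refine integral_mono .of_finite .of_finite fun y => ?_
    have h1 := variance_le_sq_of_abs_sub_le μ (fun x => f (x, y)) c fun x x' => h x x' y
    rw [variance_eq_sub (memLp_two_of_finite _ _)] at h1
    simp only [Pi.pow_apply] at h1 ⊢
    linarith
  rw [integral_add .of_finite .of_finite] at key
  simp only [integral_const, probReal_univ, one_smul] at key
  linarith

/-- A bounded differences inequality for the variance: if changing the `i`-th coordinate changes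
`f` by at most `c i`, then the variance of `f` under a product measure is at most
`∑ i, c i ^ 2`. -/
theorem variance_pi_le (μ : Measure α) [IsProbabilityMeasure μ] {n : ℕ} (f : (Fin n → α) → ℝ)
    (c : Fin n → ℝ) (h : ∀ x i a, |f x - f (Function.update x i a)| ≤ c i) :
    Var[f; Measure.pi fun _ : Fin n => μ] ≤ ∑ i, c i ^ 2 := by
  induction n with
  | zero =>
    have := variance_le_sq_of_abs_sub_le (Measure.pi fun _ : Fin 0 => μ) f 0 fun x y => by
      rw [Subsingleton.elim x y]; simp
    simpa using this
  | succ n ih =>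
    have hmp := (measurePreserving_piFinSuccAbove (fun _ : Fin (n + 1) => μ) 0).symm
    have hv : Var[f; Measure.pi fun _ : Fin (n + 1) => μ] =
        Var[fun z : α × (Fin n → α) => f (Fin.cons z.1 z.2 : Fin (n + 1) → α);
          μ.prod (Measure.pi fun _ : Fin n => μ)] := by
      rw [← hmp.map_eq, variance_map (measurable_of_finite f).aemeasurable
        hmp.measurable.aemeasurable]
      congr 1
      ext z
      simp [MeasurableEquiv.piFinSuccAbove_symm_apply, Fin.insertNthEquiv]
    rw [hv, Fin.sum_univ_succ]
    refine (variance_prod_le _ _ _ (c 0) fun x x' y => ?_).trans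
      (add_le_add_right (ih _ (fun i => c i.succ) fun y i a => ?_) _)
    · simpa using h (Fin.cons x y) 0 x'
    -- Averaging over the first coordinate preserves the bounds for the other coordinates.
    · rw [← integral_sub .of_finite .of_finite]
      refine (abs_integral_le_integral_abs).trans
        ((integral_mono .of_finite .of_finite (g := fun _ => c i.succ) fun x => ?_).trans ?_)
      · simpa [Fin.cons_update] using h (Fin.cons x y) i.succ a
      · simp

/-- Chebyshev's inequality for the lower half tail. -/
lemma measureReal_lt_half_le (μ : Measure α) [IsProbabilityMeasure μ] (f : α → ℝ) (m v : ℝ)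
    (hm : 0 < m) (hE : m ≤ ∫ x, f x ∂μ) (hv : Var[f; μ] ≤ v) :
    μ.real {x | f x < m / 2} ≤ 4 * v / m ^ 2 := by
  have hv0 : 0 ≤ v := (variance_nonneg f μ).trans hv
  refine ENNReal.toReal_le_of_le_ofReal (by positivity) ((measure_mono fun x hx => ?_).trans
    ((meas_ge_le_variance_div_sq (memLp_two_of_finite μ f) (half_pos hm)).trans
      (ENNReal.ofReal_le_ofReal ?_)))
  · simp only [Set.mem_ofPred_eq] at hx ⊢
    rw [abs_sub_comm]
    exact le_trans (by linarith) (le_abs_self _)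
  · calc Var[f; μ] / (m / 2) ^ 2 ≤ v / (m / 2) ^ 2 := by gcongr
      _ = 4 * v / m ^ 2 := by field_simp; ring

end BoundedDifferences

/-! ### Stationarity of the walk on a regular graph -/

section WalkLaw

variable {V : Type*} [Fintype V] (G : SimpleGraph V) [DecidableRel G.Adj] {d : ℕ}

lemma sum_stepProb_right (hd : 1 ≤ d) (hG : G.IsRegularOfDegree d) (x : V) :
    ∑ y, stepProb G x y = 1 := by
  have hd0 : (d : ℝ≥0∞) ≠ 0 := by exact_mod_cast (by lia : d ≠ 0)
  simp only [stepProb, ← Finset.sum_filter, Finset.sum_const,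
    ← G.neighborFinset_eq_filter, G.card_neighborFinset_eq_degree, hG x, nsmul_eq_mul]
  exact ENNReal.mul_inv_cancel hd0 (ENNReal.natCast_ne_top _)

lemma sum_stepProb_left (hd : 1 ≤ d) (hG : G.IsRegularOfDegree d) (y : V) :
    ∑ x, stepProb G x y = 1 := by
  rw [← sum_stepProb_right G hd hG y]
  simp only [stepProb, hG _, G.adj_comm]

/-- Product of the transition probabilities along a path. -/
noncomputable def pathWeight (T : ℕ) (p : Fin (T + 1) → V) : ℝ≥0∞ :=
  ∏ s : Fin T, stepProb G (p s.castSucc) (p s.succ)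

lemma pathWeight_cons (T : ℕ) (x : V) (p : Fin (T + 1) → V) :
    pathWeight G (T + 1) (Fin.cons x p : Fin (T + 2) → V) =
      stepProb G x (p 0) * pathWeight G T p := by
  simp [pathWeight, Fin.prod_univ_succ]

lemma pathWeight_snoc (T : ℕ) (p : Fin (T + 1) → V) (x : V) :
    pathWeight G (T + 1) (Fin.snoc p x : Fin (T + 2) → V) =
      pathWeight G T p * stepProb G (p (Fin.last T)) x := by
  rw [pathWeight, Fin.prod_univ_castSucc]
  congr 1
  · simp [pathWeight, Fin.succ_castSucc, -Fin.castSucc_succ]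
  · rw [Fin.succ_last, Fin.snoc_last, Fin.snoc_castSucc]

open Classical in
-- The transition matrix is doubly stochastic. Vertices after time `k` are summed out by row sums,
-- those before it by column sums.
lemma sum_pathWeight (hd : 1 ≤ d) (hG : G.IsRegularOfDegree d) (T : ℕ) (k : Fin (T + 1)) (u : V) :
    ∑ p : Fin (T + 1) → V, (if p k = u then pathWeight G T p else 0) = 1 := by
  induction T with
  | zero =>
    rw [← (Equiv.funUnique (Fin 1) V).symm.sum_comp]
    simp [pathWeight]
  | succ T ih =>
    induction k using Fin.cases with
    | zero =>
      rw [← (Fin.snocEquiv fun _ => V).sum_comp, Fintype.sum_prod_type_right, ← ih 0]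
      refine Finset.sum_congr rfl fun p _ => ?_
      have h0 : ∀ x : V, (Fin.snoc p x : Fin (T + 2) → V) 0 = p 0 := fun x => by
        rw [← Fin.castSucc_zero, Fin.snoc_castSucc]
      simp only [Fin.snocEquiv, Equiv.coe_fn_mk, h0, pathWeight_snoc]
      split_ifs with h
      · rw [← Finset.mul_sum, sum_stepProb_right G hd hG, mul_one]
      · simp
    | succ k =>
      rw [← (Fin.consEquiv fun _ => V).sum_comp, Fintype.sum_prod_type_right, ← ih k]
      refine Finset.sum_congr rfl fun p _ => ?_
      simp only [Fin.consEquiv, Equiv.coe_fn_mk, Fin.cons_succ, pathWeight_cons]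
      split_ifs with h
      · rw [← Finset.sum_mul, sum_stepProb_left G hd hG, one_mul]
      · simp

variable [MeasurableSpace V] [DiscreteMeasurableSpace V]

/-- On a regular graph the walk is uniformly distributed at every time. -/
lemma walkLaw_apply_eq (hd : 1 ≤ d) (hG : G.IsRegularOfDegree d) (T : ℕ) (k : Fin (T + 1))
    (u : V) : walkLaw G T {p | p k = u} = (Fintype.card V : ℝ≥0∞)⁻¹ := by
  classical
  have h := sum_pathWeight G hd hG T k u
  simp only [walkLaw, Measure.coe_finsetSum, Measure.coe_smul, Finset.sum_apply, Pi.smul_apply,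
    smul_eq_mul]
  conv_rhs => rw [← mul_one (Fintype.card V : ℝ≥0∞)⁻¹, ← h, Finset.mul_sum]
  refine Finset.sum_congr rfl fun p _ => ?_
  rw [Measure.dirac_apply]
  by_cases hp : p k = u <;> simp [hp, pathWeight]

lemma isProbabilityMeasure_walkLaw [Nonempty V] (hd : 1 ≤ d) (hG : G.IsRegularOfDegree d) (T : ℕ) :
    IsProbabilityMeasure (walkLaw G T) := by
  constructor
  have h : (Set.univ : Set (Fin (T + 1) → V)) = ⋃ u ∈ (Finset.univ : Finset V), {p | p 0 = u} := by
    ext; simp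
  rw [h, measure_biUnion_finset]
  · simp only [walkLaw_apply_eq G hd hG, Finset.sum_const, Finset.card_univ, nsmul_eq_mul]
    exact ENNReal.mul_inv_cancel (by simp) (ENNReal.natCast_ne_top _)
  · intro u _ v _ huv
    exact Set.disjoint_left.2 fun p hp hp' => huv (hp.symm.trans hp')
  · intro u _
    exact .of_discrete

end WalkLaw

/-! ### Unmet walks for given numbers of moves -/

section Unmet

open Classical in
/-- The walks that never move and whose starting vertex is not visited by any other walk, when
walk `j` makes `m j` moves along the path `p j`. -/
noncomputable def unmet {V : Type*} {n T : ℕ} (m : Fin n → ℕ) (p : Fin n → Fin (T + 1) → V) :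
    Finset (Fin n) :=
  Finset.univ.filter fun i => m i = 0 ∧
    ∀ j, j ≠ i → ∀ k : Fin (T + 1), (k : ℕ) ≤ m j → p j k ≠ p i 0

lemma mem_unmet {V : Type*} {n T : ℕ} {m : Fin n → ℕ} {p : Fin n → Fin (T + 1) → V} {i : Fin n} :
    i ∈ unmet m p ↔ m i = 0 ∧ ∀ j, j ≠ i → ∀ k : Fin (T + 1), (k : ℕ) ≤ m j → p j k ≠ p i 0 := by
  simp [unmet]

lemma card_filter_le_val (T m : ℕ) :
    (Finset.univ.filter fun k : Fin (T + 1) => (k : ℕ) ≤ m).card ≤ m + 1 := by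
  calc _ = ((Finset.univ.filter fun k : Fin (T + 1) => (k : ℕ) ≤ m).map Fin.valEmbedding).card :=
        (Finset.card_map _).symm
    _ ≤ (Finset.range (m + 1)).card := Finset.card_le_card fun k => by simp; lia
    _ = m + 1 := Finset.card_range _

/-- Besides `j` itself, the new path can spoil only walks starting at one of its at most `m j + 1`
vertices. Unmet walks have distinct starting vertices, so there are at most `m j + 1` of these. -/
lemma card_unmet_le {V : Type*} {n T : ℕ} (m : Fin n → ℕ) (p p' : Fin n → Fin (T + 1) → V)
    (j : Fin n) (h : ∀ i, i ≠ j → p i = p' i) :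
    (unmet m p).card ≤ (unmet m p').card + (m j + 2) := by
  classical
  set K := Finset.univ.filter fun k : Fin (T + 1) => (k : ℕ) ≤ m j
  set B := (unmet m p).filter fun i => i ≠ j ∧ p i 0 ∈ K.image (p' j)
  have hB : B.card ≤ m j + 1 := by
    refine (Finset.card_le_card_of_injOn (fun i => p i 0) (t := K.image (p' j))
      (fun i hi => (Finset.mem_filter.1 hi).2.2) fun i hi i' hi' hii => ?_).trans
      (Finset.card_image_le.trans (card_filter_le_val T (m j)))
    by_contra hne
    exact (mem_unmet.1 (Finset.mem_filter.1 hi).1).2 i' (Ne.symm hne) 0 (by simp) hii.symm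
  have hsub : unmet m p ⊆ unmet m p' ∪ insert j B := by
    intro i hi
    by_cases hij : i = j
    · simp [hij]
    by_cases hiB : i ∈ B
    · simp [hiB]
    refine Finset.mem_union_left _ (mem_unmet.2 ⟨(mem_unmet.1 hi).1, fun l hl k hk => ?_⟩)
    rw [← h i hij]
    by_cases hlj : l = j
    · subst hlj
      exact fun heq => hiB (Finset.mem_filter.2 ⟨hi, hij,
        Finset.mem_image.2 ⟨k, by simp [K, hk], heq⟩⟩)
    · rw [← h l hlj]
      exact (mem_unmet.1 hi).2 l hl k hk
  have := (Finset.card_le_card hsub).trans (Finset.card_union_le _ _)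
  have := Finset.card_insert_le j B
  lia

lemma abs_card_unmet_sub_le {V : Type*} {n T : ℕ} (m : Fin n → ℕ) (p : Fin n → Fin (T + 1) → V)
    (j : Fin n) (q : Fin (T + 1) → V) :
    |((unmet m p).card : ℝ) - (unmet m (Function.update p j q)).card| ≤ (m j : ℝ) + 2 := by
  have h : ∀ i, i ≠ j → p i = Function.update p j q i := fun i hi => by
    rw [Function.update_of_ne hi]
  have h1 := card_unmet_le m p _ j h
  have h2 := card_unmet_le m _ p j fun i hi => (h i hi).symm
  rw [abs_le]
  constructor
  · rw [neg_le_sub_iff_le_add]; exact_mod_cast (by lia)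
  · rw [sub_le_iff_le_add]; exact_mod_cast (by lia)

variable {V : Type*} [Fintype V] [MeasurableSpace V] [DiscreteMeasurableSpace V]
  (G : SimpleGraph V) [DecidableRel G.Adj] {d : ℕ}

lemma walkLaw_real_apply_eq (hd : 1 ≤ d) (hG : G.IsRegularOfDegree d) (T : ℕ) (k : Fin (T + 1))
    (u : V) : (walkLaw G T).real {p | p k = u} = (Fintype.card V : ℝ)⁻¹ := by
  simp [measureReal_def, walkLaw_apply_eq G hd hG]

lemma le_walkLaw_real_forall_ne [Nonempty V] (hd : 1 ≤ d) (hG : G.IsRegularOfDegree d) (T m : ℕ)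
    (u : V) :
    1 - ((m : ℝ) + 1) / Fintype.card V ≤
      (walkLaw G T).real {p | ∀ k : Fin (T + 1), (k : ℕ) ≤ m → p k ≠ u} := by
  have := isProbabilityMeasure_walkLaw G hd hG T
  set K := Finset.univ.filter fun k : Fin (T + 1) => (k : ℕ) ≤ m
  have hc : {p : Fin (T + 1) → V | ∀ k : Fin (T + 1), (k : ℕ) ≤ m → p k ≠ u} =
      (⋃ k ∈ K, {p | p k = u})ᶜ := by
    ext p; simp [K]
  rw [hc, probReal_compl_eq_one_sub .of_discrete]
  refine sub_le_sub_left ((measureReal_biUnion_finset_le _ _).trans ?_) _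
  simp only [walkLaw_real_apply_eq G hd hG, Finset.sum_const, nsmul_eq_mul, div_eq_mul_inv]
  gcongr
  exact_mod_cast card_filter_le_val T m

lemma measureReal_pi {ι α : Type*} [Fintype ι] [MeasurableSpace α] (μ : Measure α)
    [SigmaFinite μ] (s : ι → Set α) :
    (Measure.pi fun _ : ι => μ).real (Set.univ.pi s) = ∏ i, μ.real (s i) := by
  simp [measureReal_def, Measure.pi_pi, ENNReal.toReal_prod]

/-- Splitting by the starting vertex `u` of walk `i` turns the event into disjoint boxes, whose
measures factor. -/
lemma le_measureReal_mem_unmet [Nonempty V] (hd : 1 ≤ d) (hG : G.IsRegularOfDegree d) {n : ℕ} (T : ℕ)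
    (m : Fin n → ℕ) (hm : ∀ j, ((m j : ℝ) + 1) / Fintype.card V ≤ 1) (i : Fin n) (hi : m i = 0) :
    ∏ j, (1 - ((m j : ℝ) + 1) / Fintype.card V) ≤
      (Measure.pi fun _ : Fin n => walkLaw G T).real {p | i ∈ unmet m p} := by
  have := isProbabilityMeasure_walkLaw G hd hG T
  have hn : (0 : ℝ) < Fintype.card V := by exact_mod_cast Fintype.card_pos
  set A : V → Fin n → Set (Fin (T + 1) → V) := fun u j =>
    if j = i then {p | p 0 = u} else {p | ∀ k : Fin (T + 1), (k : ℕ) ≤ m j → p k ≠ u} with hA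
  have hset : {p : Fin n → Fin (T + 1) → V | i ∈ unmet m p} =
      ⋃ u ∈ (Finset.univ : Finset V), Set.univ.pi (A u) := by
    ext p
    simp only [Set.mem_ofPred_eq, mem_unmet, hi, true_and, Finset.mem_univ, Set.iUnion_true,
      Set.mem_iUnion, Set.mem_univ_pi]
    constructor
    · intro h
      refine ⟨p i 0, fun j => ?_⟩
      by_cases hj : j = i
      · simp [hA, hj]
      · simpa [hA, hj] using h j hj
    · rintro ⟨u, hu⟩ j hj k hk
      have h1 : p i 0 = u := by simpa [hA] using hu i
      have h2 := hu j
      simp only [hA, if_neg hj, Set.mem_ofPred_eq] at h2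
      exact h1 ▸ h2 k hk
  have hbox : ∀ u, (Fintype.card V : ℝ)⁻¹ * ∏ j, (1 - ((m j : ℝ) + 1) / Fintype.card V) ≤
      (Measure.pi fun _ : Fin n => walkLaw G T).real (Set.univ.pi (A u)) := by
    intro u
    rw [measureReal_pi, ← Finset.mul_prod_erase Finset.univ _ (Finset.mem_univ i)]
    nth_rw 1 [← Finset.mul_prod_erase Finset.univ _ (Finset.mem_univ i)]
    have h1 : (walkLaw G T).real (A u i) = (Fintype.card V : ℝ)⁻¹ := by
      simp [hA, walkLaw_real_apply_eq G hd hG]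
    rw [h1]
    refine mul_le_mul_of_nonneg_left ?_ (by positivity)
    have h2 : ∏ j ∈ Finset.univ.erase i, (1 - ((m j : ℝ) + 1) / Fintype.card V) ≤
        ∏ j ∈ Finset.univ.erase i, (walkLaw G T).real (A u j) := by
      refine Finset.prod_le_prod (fun j _ => sub_nonneg.2 (hm j)) fun j hj => ?_
      simp only [hA, if_neg (Finset.ne_of_mem_erase hj)]
      exact le_walkLaw_real_forall_ne G hd hG T (m j) u
    -- The superfluous factor for `i` is at most 1; keeping it gives a bound independent of `i`.
    refine le_trans (mul_le_of_le_one_left ?_ ?_) h2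
    · exact Finset.prod_nonneg fun j _ => sub_nonneg.2 (hm j)
    · exact sub_le_self _ (by positivity)
  rw [hset, measureReal_biUnion_finset]
  · refine le_trans (le_of_eq ?_) (Finset.sum_le_sum fun u _ => hbox u)
    rw [Finset.sum_const, Finset.card_univ, nsmul_eq_mul, mul_inv_cancel_left₀ hn.ne']
  · intro u _ v _ huv
    refine Set.disjoint_left.2 fun p hp hp' => huv ?_
    have h1 : p i 0 = u := by simpa [hA] using hp i (Set.mem_univ i)
    have h2 : p i 0 = v := by simpa [hA] using hp' i (Set.mem_univ i)
    exact h1.symm.trans h2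
  · intro u _
    exact .of_discrete

lemma integral_card_unmet {n : ℕ} {T : ℕ} (m : Fin n → ℕ)
    (μ : Measure (Fin n → Fin (T + 1) → V)) [IsProbabilityMeasure μ] :
    ∫ p, ((unmet m p).card : ℝ) ∂μ = ∑ i, μ.real {p | i ∈ unmet m p} := by
  classical
  have h : ∀ p : Fin n → Fin (T + 1) → V, ((unmet m p).card : ℝ) =
      ∑ i, {p : Fin n → Fin (T + 1) → V | i ∈ unmet m p}.indicator 1 p := fun p => by
    simp [Set.indicator_apply]
  simp only [h]
  rw [integral_finsetSum _ fun i _ => .of_finite]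
  exact Finset.sum_congr rfl fun i _ => integral_indicator_one .of_discrete

/-- `-log (1 - x) ≤ x / (1 - x)`, and `1 - x ≥ 9/10`. -/
lemma exp_neg_le_one_sub {x : ℝ} (h1 : x ≤ 1 / 10) (h0 : 0 ≤ x) :
    Real.exp (-(10 / 9 * x)) ≤ 1 - x := by
  rw [← Real.le_log_iff_exp_le (by linarith)]
  refine le_trans ?_ (Real.one_sub_inv_le_log_of_pos (by linarith))
  rw [le_sub_iff_add_le, ← le_sub_iff_add_le', inv_le_iff_one_le_mul₀ (by linarith)]
  nlinarith

/-- The expected number of walks that are never met, given the numbers of moves. -/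
lemma le_integral_card_unmet [Nonempty V] (hd : 1 ≤ d) (hG : G.IsRegularOfDegree d) {n : ℕ} (T : ℕ)
    (m : Fin n → ℕ) (hm : ∀ j, ((m j : ℝ) + 1) / Fintype.card V ≤ 1 / 10) :
    ((Finset.univ.filter fun i => m i = 0).card : ℝ) *
        Real.exp (-(10 / 9 * ((∑ j, (m j : ℝ)) + n) / Fintype.card V)) ≤
      ∫ p, ((unmet m p).card : ℝ) ∂(Measure.pi fun _ : Fin n => walkLaw G T) := by
  have := isProbabilityMeasure_walkLaw G hd hG T
  rw [integral_card_unmet, ← nsmul_eq_mul]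
  refine le_trans ?_ (Finset.sum_le_sum_of_subset_of_nonneg
    (Finset.subset_univ (Finset.univ.filter fun i => m i = 0)) fun _ _ _ => measureReal_nonneg)
  refine Finset.card_nsmul_le_sum _ _ _ fun i hi => le_trans ?_
    (le_measureReal_mem_unmet G hd hG T m (fun j => (hm j).trans (by norm_num)) i
      (Finset.mem_filter.1 hi).2)
  have hexp : Real.exp (-(10 / 9 * ((∑ j, (m j : ℝ)) + n) / Fintype.card V)) =
      ∏ j, Real.exp (-(10 / 9 * (((m j : ℝ) + 1) / Fintype.card V))) := by
    rw [← Real.exp_sum, Finset.sum_neg_distrib, ← Finset.mul_sum, ← Finset.sum_div,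
      Finset.sum_add_distrib]
    simp [mul_div_assoc]
  rw [hexp]
  exact Finset.prod_le_prod (fun _ _ => (Real.exp_pos _).le) fun j _ =>
    exp_neg_le_one_sub (hm j) (by positivity)

lemma measureReal_card_unmet_lt_le [Nonempty V] (hd : 1 ≤ d) (hG : G.IsRegularOfDegree d) {n : ℕ}
    (T : ℕ) (m : Fin n → ℕ) (hm : ∀ j, ((m j : ℝ) + 1) / Fintype.card V ≤ 1 / 10) (a : ℝ) (ha : 0 < a)
    (hS : a ≤ ((Finset.univ.filter fun i => m i = 0).card : ℝ) *
      Real.exp (-(10 / 9 * ((∑ j, (m j : ℝ)) + n) / Fintype.card V))) :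
    (Measure.pi fun _ : Fin n => walkLaw G T).real {p | ((unmet m p).card : ℝ) < a / 2} ≤
      4 * (∑ j, ((m j : ℝ) + 2) ^ 2) / a ^ 2 := by
  have := isProbabilityMeasure_walkLaw G hd hG T
  exact measureReal_lt_half_le _ _ _ _ ha (hS.trans (le_integral_card_unmet G hd hG T m hm))
    (variance_pi_le _ _ _ fun p j q => abs_card_unmet_sub_le m p j q)

end Unmet

/-! ### The random schedule: resting walks and second moment of the moves -/

section Schedule

variable {n T : ℕ}

lemma moves_last (σ : Fin T → Fin n) (i : Fin n) :
    moves σ i T = (Finset.univ.filter fun s => σ s = i).card := by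
  simp [moves]

lemma moves_le_last (σ : Fin T → Fin n) (i : Fin n) (t : ℕ) : moves σ i t ≤ moves σ i T := by
  rw [moves_last]
  exact Finset.card_le_card fun s hs => by simp_all

lemma sum_moves (σ : Fin T → Fin n) : ∑ i, moves σ i T = T := by
  simp only [moves_last]
  rw [← Finset.card_eq_sum_card_fiberwise (t := Finset.univ) fun _ _ => Finset.mem_univ _,
    Finset.card_univ, Fintype.card_fin]

/-- The walks that never move. -/
def resting (σ : Fin T → Fin n) : Finset (Fin n) :=
  Finset.univ.filter fun i => moves σ i T = 0

lemma mem_resting {σ : Fin T → Fin n} {i : Fin n} : i ∈ resting σ ↔ ∀ s, σ s ≠ i := by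
  simp [resting, moves_last, Finset.filter_eq_empty_iff]

/-- Only the walk `σ' s` can cease to rest. -/
lemma card_resting_le (σ σ' : Fin T → Fin n) (s : Fin T) (h : ∀ t, t ≠ s → σ t = σ' t) :
    (resting σ).card ≤ (resting σ').card + 1 := by
  refine (Finset.card_le_card (t := insert (σ' s) (resting σ')) fun i hi => ?_).trans
    (Finset.card_insert_le _ _)
  by_cases his : i = σ' s
  · simp [his]
  refine Finset.mem_insert_of_mem (mem_resting.2 fun t => ?_)
  by_cases hts : t = s
  · exact hts ▸ Ne.symm his
  · exact h t hts ▸ mem_resting.1 hi t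

lemma abs_card_resting_sub_le (σ : Fin T → Fin n) (s : Fin T) (a : Fin n) :
    |((resting σ).card : ℝ) - (resting (Function.update σ s a)).card| ≤ 1 := by
  have h : ∀ t, t ≠ s → σ t = Function.update σ s a t := fun t ht => by
    rw [Function.update_of_ne ht]
  have h1 := card_resting_le σ _ s h
  have h2 := card_resting_le _ σ s fun t ht => (h t ht).symm
  rw [abs_le]
  constructor
  · rw [neg_le_sub_iff_le_add]; exact_mod_cast h2
  · rw [sub_le_iff_le_add]; exact_mod_cast (by lia)

lemma uniformOn_univ_real_singleton [NeZero n] (i : Fin n) :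
    (uniformOn (Set.univ : Set (Fin n))).real {i} = 1 / n := by
  simp [measureReal_def, uniformOn_univ]

lemma integral_card_resting [NeZero n] :
    ∫ σ, ((resting σ).card : ℝ)
      ∂(Measure.pi fun _ : Fin T => uniformOn (Set.univ : Set (Fin n))) =
      n * (1 - 1 / n) ^ T := by
  have h : ∀ σ : Fin T → Fin n, ((resting σ).card : ℝ) =
      ∑ i, {σ : Fin T → Fin n | i ∈ resting σ}.indicator 1 σ := fun σ => by
    simp [Set.indicator_apply]
  have h2 : ∀ i, {σ : Fin T → Fin n | i ∈ resting σ} = Set.univ.pi fun _ => {i}ᶜ := fun i => by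
    ext σ
    simp [mem_resting]
  simp only [h]
  rw [integral_finsetSum _ fun i _ => .of_finite]
  simp only [integral_indicator_one (MeasurableSet.of_discrete), h2, measureReal_pi,
    probReal_compl_eq_one_sub (MeasurableSet.of_discrete), uniformOn_univ_real_singleton]
  simp

lemma measureReal_card_resting_lt_le [NeZero n] (a : ℝ) (ha : 0 < a)
    (h : a ≤ n * (1 - 1 / n : ℝ) ^ T) :
    (Measure.pi fun _ : Fin T => uniformOn (Set.univ : Set (Fin n))).real
      {σ | ((resting σ).card : ℝ) < a / 2} ≤ 4 * T / a ^ 2 := by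
  have hv := variance_pi_le (uniformOn (Set.univ : Set (Fin n)))
    (fun σ : Fin T → Fin n => ((resting σ).card : ℝ)) (fun _ => 1) abs_card_resting_sub_le
  refine measureReal_lt_half_le _ _ _ _ ha (h.trans_eq integral_card_resting.symm)
    (hv.trans_eq (by simp))

lemma measureReal_eq_and_eq [NeZero n] (s t : Fin T) (i : Fin n) :
    (Measure.pi fun _ : Fin T => uniformOn (Set.univ : Set (Fin n))).real
      {σ | σ s = i ∧ σ t = i} = if s = t then 1 / (n : ℝ) else 1 / (n : ℝ) ^ 2 := by
  have h : {σ : Fin T → Fin n | σ s = i ∧ σ t = i} =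
      Set.univ.pi fun r => if r ∈ ({s, t} : Finset (Fin T)) then {i} else Set.univ := by
    ext σ
    simp only [Set.mem_ofPred_eq, Set.mem_univ_pi]
    constructor
    · rintro ⟨hs, ht⟩ r
      split_ifs with hr
      · rcases Finset.mem_insert.1 hr with rfl | hr
        · exact hs
        · exact Finset.mem_singleton.1 hr ▸ ht
      · trivial
    · intro h
      exact ⟨by simpa using h s, by simpa using h t⟩
  rw [h, measureReal_pi]
  simp only [apply_ite (Measure.real _), uniformOn_univ_real_singleton, probReal_univ]
  rw [Finset.prod_ite_mem, Finset.univ_inter, Finset.prod_const]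
  split_ifs with hst
  · simp [hst]
  · simp [Finset.card_pair hst]

/-- The sum counts ordered pairs of time steps given to the same walk: `T` diagonal pairs, and fewer
than `T ^ 2` others (if any), each with probability `1 / n`. -/
lemma integral_sum_moves_sq_le [NeZero n] :
    ∫ σ, ∑ i, (moves σ i T : ℝ) ^ 2
      ∂(Measure.pi fun _ : Fin T => uniformOn (Set.univ : Set (Fin n))) ≤
      T + (T : ℝ) ^ 2 / n := by
  have hn : (n : ℝ) ≠ 0 := NeZero.ne _
  have h : ∀ (σ : Fin T → Fin n) i, (moves σ i T : ℝ) ^ 2 =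
      ∑ s, ∑ t, {σ : Fin T → Fin n | σ s = i ∧ σ t = i}.indicator 1 σ := fun σ i => by
    have h1 : (moves σ i T : ℝ) = ∑ s, if σ s = i then 1 else 0 := by simp [moves_last]
    rw [h1, sq, Finset.sum_mul_sum]
    refine Finset.sum_congr rfl fun s _ => Finset.sum_congr rfl fun t _ => ?_
    by_cases hs : σ s = i <;> by_cases ht : σ t = i <;> simp [hs, ht]
  simp only [h]
  rw [integral_finsetSum _ fun i _ => .of_finite]
  have h2 : ∀ i : Fin n, ∫ σ, ∑ s, ∑ t, {σ : Fin T → Fin n | σ s = i ∧ σ t = i}.indicator 1 σ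
      ∂(Measure.pi fun _ : Fin T => uniformOn (Set.univ : Set (Fin n))) ≤
      T * (1 / n) + (T : ℝ) ^ 2 * (1 / (n : ℝ) ^ 2) := fun i => by
    rw [integral_finsetSum _ fun s _ => .of_finite]
    simp only [integral_finsetSum _ fun (t : Fin T) _ => Integrable.of_finite,
      integral_indicator_one (MeasurableSet.of_discrete), measureReal_eq_and_eq]
    calc _ ≤ ∑ s : Fin T, ∑ t : Fin T, ((if s = t then 1 / (n : ℝ) else 0) + 1 / (n : ℝ) ^ 2) := by
          refine Finset.sum_le_sum fun s _ => Finset.sum_le_sum fun t _ => ?_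
          split_ifs <;> simp
      _ = _ := by
          simp only [Finset.sum_add_distrib, Finset.sum_ite_eq, Finset.mem_univ, if_true,
            Finset.sum_const, Finset.card_univ, Fintype.card_fin, nsmul_eq_mul]
          ring
  refine (Finset.sum_le_sum fun i _ => h2 i).trans_eq ?_
  simp only [Finset.sum_const, Finset.card_univ, Fintype.card_fin, nsmul_eq_mul]
  field_simp

lemma measureReal_sum_moves_ge_le [NeZero n] (b : ℝ) (hb : 0 < b) :
    (Measure.pi fun _ : Fin T => uniformOn (Set.univ : Set (Fin n))).real
      {σ | b ≤ ∑ i, ((moves σ i T : ℝ) + 2) ^ 2} ≤ (5 * T + (T : ℝ) ^ 2 / n + 4 * n) / b := by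
  have h : ∀ σ : Fin T → Fin n, ∑ i, ((moves σ i T : ℝ) + 2) ^ 2 =
      ∑ i, (moves σ i T : ℝ) ^ 2 + (4 * T + 4 * n) := fun σ => by
    have h1 : ∑ i, (moves σ i T : ℝ) = T := by exact_mod_cast sum_moves σ
    simp only [add_sq, Finset.sum_add_distrib, mul_assoc, ← Finset.mul_sum, ← Finset.sum_mul, h1]
    simp
    ring
  rw [le_div_iff₀' hb]
  refine (mul_meas_ge_le_integral_of_nonneg (Filter.Eventually.of_forall fun σ => ?_)
    .of_finite b).trans ?_
  · exact Finset.sum_nonneg fun i _ => sq_nonneg _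
  simp only [h]
  rw [integral_add .of_finite .of_finite]
  have := integral_sum_moves_sq_le (n := n) (T := T)
  simp only [integral_const, probReal_univ, one_smul]
  linarith

end Schedule

/-- Being unmet ignores timing, so it is stronger than being lonely. -/
lemma isLonely_of_mem_unmet {V : Type*} {n T : ℕ} (ω : Outcome V n T) (i : Fin n)
    (h : i ∈ unmet (fun j => moves ω.2 j T) ω.1) : IsLonely ω i := by
  intro j hj t _
  have h0 : moves ω.2 i t = 0 :=
    Nat.le_zero.1 ((moves_le_last ω.2 i t).trans (mem_unmet.1 h).1.le)
  have h1 : position ω i t = ω.1 i 0 := by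
    simp only [position, h0]
    rfl
  rw [h1]
  exact (mem_unmet.1 h).2 j hj _ (moves_le_last ω.2 j t)

lemma measureReal_prod_le {α β : Type*} [Finite α] [MeasurableSpace α] [MeasurableSingletonClass α]
    [Finite β] [MeasurableSpace β] [MeasurableSingletonClass β] (μ : Measure α)
    [IsProbabilityMeasure μ] (ν : Measure β) [IsProbabilityMeasure ν] (B : Set (α × β)) (A : Set β)
    (δ : ℝ) (hδ : 0 ≤ δ) (h : ∀ y, y ∉ A → μ.real {x | (x, y) ∈ B} ≤ δ) :
    (μ.prod ν).real B ≤ ν.real A + δ := by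
  rw [← integral_indicator_one (.of_discrete), integral_prod_symm _ .of_finite]
  have h1 : ∀ y, ∫ x, B.indicator 1 (x, y) ∂μ = μ.real {x | (x, y) ∈ B} := fun y => by
    rw [← integral_indicator_one (.of_discrete)]
    rfl
  simp only [h1]
  refine (integral_mono .of_finite .of_finite (g := fun y => A.indicator 1 y + δ)
    fun y => ?_).trans ?_
  · by_cases hy : y ∈ A
    · simpa [hy] using (measureReal_le_one (μ := μ)).trans (le_add_of_nonneg_right hδ)
    · simpa [hy] using h y hy
  · rw [integral_add .of_finite .of_finite, integral_indicator_one (.of_discrete)]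
    simp

/-! ### Combining schedule and trajectories -/

section Main

variable {V : Type*} [Fintype V] [Nonempty V] [MeasurableSpace V] [DiscreteMeasurableSpace V]
  (G : SimpleGraph V) [DecidableRel G.Adj] {d : ℕ}

lemma systemLaw_real_card_unmet_lt_le (hd : 1 ≤ d) (hG : G.IsRegularOfDegree d) {n : ℕ} [NeZero n]
    (hn : Fintype.card V = n) (T : ℕ) {r a b : ℝ} (hr : 0 < r) (ha : 0 < a) (hb : 0 < b)
    (hr' : r ≤ n * (1 - 1 / n : ℝ) ^ T) (hb' : b ≤ ((n : ℝ) / 10) ^ 2)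
    (ha' : a ≤ r / 2 * Real.exp (-(10 / 9 * ((T : ℝ) + n) / n))) :
    (systemLaw G n T).real
      {ω | ((unmet (fun j => moves ω.2 j T) ω.1).card : ℝ) < a / 2} ≤
      (5 * T + (T : ℝ) ^ 2 / n + 4 * n) / b + 4 * T / r ^ 2 + 4 * b / a ^ 2 := by
  have := isProbabilityMeasure_walkLaw G hd hG T
  have hn0 : (0 : ℝ) < n := by exact_mod_cast NeZero.pos n
  refine (measureReal_prod_le _ _ _
    ({σ | b ≤ ∑ i, ((moves σ i T : ℝ) + 2) ^ 2} ∪ {σ | ((resting σ).card : ℝ) < r / 2})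
    (4 * b / a ^ 2) (by positivity) fun σ hσ => ?_).trans
    (add_le_add_left ((measureReal_union_le _ _).trans
      (add_le_add (measureReal_sum_moves_ge_le b hb)
        (measureReal_card_resting_lt_le r hr hr'))) _)
  simp only [Set.mem_union, Set.mem_ofPred_eq, not_or, not_le, not_lt] at hσ
  obtain ⟨hσb, hσr⟩ := hσ
  -- The bound on the sum of squares also controls each single walk.
  have hm : ∀ j, ((moves σ j T : ℝ) + 1) / Fintype.card V ≤ 1 / 10 := fun j => by
    have h1 : ((moves σ j T : ℝ) + 2) ^ 2 ≤ ((n : ℝ) / 10) ^ 2 :=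
      ((Finset.single_le_sum (f := fun i => ((moves σ i T : ℝ) + 2) ^ 2)
        (fun i _ => sq_nonneg _) (Finset.mem_univ j)).trans hσb.le).trans hb'
    have h2 := le_of_sq_le_sq h1 (by positivity)
    rw [hn, div_le_iff₀ hn0]
    linarith
  refine (measureReal_card_unmet_lt_le G hd hG T (fun j => moves σ j T) hm a ha
    (ha'.trans ?_)).trans ?_
  · have hs : ∑ j, (moves σ j T : ℝ) = T := by exact_mod_cast sum_moves σ
    rw [hs, hn]
    exact mul_le_mul_of_nonneg_right hσr (Real.exp_pos _).le
  · gcongr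

end Main

lemma natFloor_mul_log_le {n : ℕ} :
    (⌊(0.1 : ℝ) * n * Real.log n⌋₊ : ℝ) ≤ 0.1 * n * Real.log n :=
  Nat.floor_le (mul_nonneg (by positivity) (Real.log_natCast_nonneg n))

lemma rpow_le_exp_neg {n : ℕ} (hn : 0 < n) {T : ℝ} (hT : T ≤ 0.1 * n * Real.log n) :
    (n : ℝ) ^ (-1 / 9 : ℝ) ≤ Real.exp (-(10 / 9 * (T / n))) := by
  have hn0 : (0 : ℝ) < n := by exact_mod_cast hn
  rw [Real.rpow_def_of_pos hn0, Real.exp_le_exp]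
  have : T / n ≤ 0.1 * Real.log n := by
    rw [div_le_iff₀ hn0]
    linarith
  linarith

lemma rpow_le_mul_one_sub_pow {n T : ℕ} (hn : 10 ≤ n) (hT : (T : ℝ) ≤ 0.1 * n * Real.log n) :
    (n : ℝ) ^ (8 / 9 : ℝ) ≤ n * (1 - 1 / n : ℝ) ^ T := by
  have hn0 : (0 : ℝ) < n := by exact_mod_cast (by lia : 0 < n)
  have hn10 : (10 : ℝ) ≤ n := by exact_mod_cast hn
  have h1 : (n : ℝ) ^ (8 / 9 : ℝ) = n * (n : ℝ) ^ (-1 / 9 : ℝ) := by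
    rw [← Real.rpow_one_add' hn0.le (by norm_num)]
    norm_num
  rw [h1]
  refine mul_le_mul_of_nonneg_left ((rpow_le_exp_neg (by lia) hT).trans ?_) hn0.le
  have h2 : Real.exp (-(10 / 9 * (T / n))) = Real.exp (-(10 / 9 * (1 / n))) ^ T := by
    rw [← Real.exp_nat_mul]
    congr 1
    ring
  rw [h2]
  refine pow_le_pow_left₀ (Real.exp_pos _).le (exp_neg_le_one_sub ?_ (by positivity)) _
  exact one_div_le_one_div_of_le (by norm_num) hn10

/-- With `T ≤ 2 n ^ (21/20)`, the three terms have exponents at most `11/10 - 6/5`, `21/20 - 16/9`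
and `6/5 - 14/9`, none above `-1/10`. -/
lemma error_le {n T : ℕ} (hn : 1 ≤ n) (hT : (T : ℝ) ≤ 0.1 * n * Real.log n) {κ : ℝ} (hκ : 0 < κ) :
    (5 * T + (T : ℝ) ^ 2 / n + 4 * n) / (n : ℝ) ^ (6 / 5 : ℝ) +
        4 * T / ((n : ℝ) ^ (8 / 9 : ℝ)) ^ 2 +
        4 * (n : ℝ) ^ (6 / 5 : ℝ) / (κ * (n : ℝ) ^ (7 / 9 : ℝ)) ^ 2 ≤
      (26 + 4 / κ ^ 2) * (n : ℝ) ^ (-(1 / 10) : ℝ) := by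
  have hn1 : (1 : ℝ) ≤ n := by exact_mod_cast hn
  have hn0 : (0 : ℝ) < n := by linarith
  have hT2 : (T : ℝ) ≤ 2 * (n : ℝ) ^ (21 / 20 : ℝ) := by
    have hlog := Real.log_le_rpow_div hn0.le (by norm_num : (0 : ℝ) < 1 / 20)
    calc (T : ℝ) ≤ 0.1 * n * Real.log n := hT
      _ ≤ 0.1 * n * ((n : ℝ) ^ (1 / 20 : ℝ) / (1 / 20)) := by gcongr
      _ = 2 * (n * (n : ℝ) ^ (1 / 20 : ℝ)) := by ring
      _ = 2 * (n : ℝ) ^ (21 / 20 : ℝ) := by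
        rw [← Real.rpow_one_add' hn0.le (by norm_num)]
        norm_num
  have hmono : ∀ {x y : ℝ}, x ≤ y → (n : ℝ) ^ x ≤ (n : ℝ) ^ y := fun h =>
    Real.rpow_le_rpow_of_exponent_le hn1 h
  have h1 : (5 * T + (T : ℝ) ^ 2 / n + 4 * n) / (n : ℝ) ^ (6 / 5 : ℝ) ≤
      18 * (n : ℝ) ^ (-(1 / 10) : ℝ) := by
    rw [div_le_iff₀ (by positivity), mul_assoc, ← Real.rpow_add hn0]
    have e1 : (T : ℝ) ^ 2 / n ≤ 4 * (n : ℝ) ^ (11 / 10 : ℝ) := by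
      calc (T : ℝ) ^ 2 / n ≤ (2 * (n : ℝ) ^ (21 / 20 : ℝ)) ^ 2 / n := by gcongr
        _ = 4 * (((n : ℝ) ^ (21 / 20 : ℝ)) ^ (2 : ℕ) / (n : ℝ) ^ (1 : ℝ)) := by
          rw [Real.rpow_one]; ring
        _ = 4 * (n : ℝ) ^ (11 / 10 : ℝ) := by
          rw [← Real.rpow_mul_natCast hn0.le, ← Real.rpow_sub hn0]
          norm_num
    have e2 : (n : ℝ) ^ (21 / 20 : ℝ) ≤ (n : ℝ) ^ (11 / 10 : ℝ) := hmono (by norm_num)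
    have e3 : (n : ℝ) ≤ (n : ℝ) ^ (11 / 10 : ℝ) := by
      simpa using hmono (by norm_num : (1 : ℝ) ≤ 11 / 10)
    have e4 : (-(1 / 10) + 6 / 5 : ℝ) = 11 / 10 := by norm_num
    rw [e4]
    linarith
  have h2 : 4 * T / ((n : ℝ) ^ (8 / 9 : ℝ)) ^ 2 ≤ 8 * (n : ℝ) ^ (-(1 / 10) : ℝ) := by
    rw [div_le_iff₀ (by positivity), ← Real.rpow_mul_natCast hn0.le, mul_assoc,
      ← Real.rpow_add hn0]
    have e1 : (n : ℝ) ^ (21 / 20 : ℝ) ≤ (n : ℝ) ^ (-(1 / 10) + 8 / 9 * (2 : ℕ) : ℝ) :=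
      hmono (by norm_num)
    linarith
  have h3 : 4 * (n : ℝ) ^ (6 / 5 : ℝ) / (κ * (n : ℝ) ^ (7 / 9 : ℝ)) ^ 2 ≤
      4 / κ ^ 2 * (n : ℝ) ^ (-(1 / 10) : ℝ) := by
    rw [mul_pow, mul_div_mul_comm, ← Real.rpow_mul_natCast hn0.le, ← Real.rpow_sub hn0]
    exact mul_le_mul_of_nonneg_left (hmono (by norm_num)) (by positivity)
  linarith

end LonelyWalkers

theorem theorem5 :
    ∃ c : ℝ, 0 < c ∧ ∀ ε : ℝ, 0 < ε → ∃ N : ℕ, ∀ n : ℕ, N ≤ n →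
      ∀ (V : Type*) [Fintype V] [MeasurableSpace V] [DiscreteMeasurableSpace V]
        (G : SimpleGraph V) [DecidableRel G.Adj] (d : ℕ),
        Fintype.card V = n → 1 ≤ d → G.IsRegularOfDegree d →
        1 - ε ≤ (LonelyWalkers.systemLaw G n ⌊(0.1 : ℝ) * n * Real.log n⌋₊).real
          {ω | c * (n : ℝ) ^ (3 / 4 : ℝ) ≤ ({i | LonelyWalkers.IsLonely ω i}.ncard : ℝ)} := by
  open LonelyWalkers in
  -- The exponential pays for the `n` starting positions, the `1/2` for Chebyshev on the resting
  -- walks. Chebyshev on the unmet walks costs the further `1/2` in `c = κ / 2`.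
  set κ : ℝ := Real.exp (-(10 / 9)) / 2 with hκ
  have hκ0 : 0 < κ := by positivity
  refine ⟨κ / 2, by positivity, fun ε hε => ?_⟩
  have hlim : Filter.Tendsto (fun n : ℕ => (n : ℝ) ^ (-(1 / 10) : ℝ)) Filter.atTop (nhds 0) :=
    (tendsto_rpow_neg_atTop (by norm_num)).comp tendsto_natCast_atTop_atTop
  have hlim' := hlim.const_mul (26 + 4 / κ ^ 2)
  rw [mul_zero] at hlim'
  obtain ⟨N, hN⟩ := Filter.eventually_atTop.1 (((hlim'.eventually_le_const hε).and
    (hlim.eventually_le_const (by norm_num : (0 : ℝ) < 1 / 10))).and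
      (Filter.eventually_ge_atTop 10))
  refine ⟨N, fun n hn V _ _ _ G _ d hV hd hG => ?_⟩
  obtain ⟨⟨hε', h10⟩, hn10⟩ := hN n hn
  have hn0 : (0 : ℝ) < n := by exact_mod_cast (by lia : 0 < n)
  have hn1 : (1 : ℝ) ≤ n := by exact_mod_cast (by lia : 1 ≤ n)
  have : NeZero n := ⟨by lia⟩
  have : Nonempty V := Fintype.card_pos_iff.1 (by lia)
  set T := ⌊(0.1 : ℝ) * n * Real.log n⌋₊
  have hT : (T : ℝ) ≤ 0.1 * n * Real.log n := natFloor_mul_log_le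
  have := isProbabilityMeasure_walkLaw G hd hG T
  have : IsProbabilityMeasure (systemLaw G n T) := by unfold systemLaw; infer_instance
  have hb : (n : ℝ) ^ (6 / 5 : ℝ) ≤ ((n : ℝ) / 10) ^ 2 := by
    have h1 : (n : ℝ) ^ (6 / 5 : ℝ) ≤ ((n : ℝ) * (n : ℝ) ^ (-(1 / 10) : ℝ)) ^ 2 := by
      rw [← Real.rpow_one_add' hn0.le (by norm_num), ← Real.rpow_mul_natCast hn0.le]
      exact Real.rpow_le_rpow_of_exponent_le hn1 (by norm_num)
    refine h1.trans ?_
    rw [div_eq_mul_one_div (n : ℝ) 10]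
    exact pow_le_pow_left₀ (by positivity) (mul_le_mul_of_nonneg_left h10 hn0.le) 2
  have ha : κ * (n : ℝ) ^ (7 / 9 : ℝ) ≤ (n : ℝ) ^ (8 / 9 : ℝ) / 2 *
      Real.exp (-(10 / 9 * ((T : ℝ) + n) / n)) := by
    have h1 : Real.exp (-(10 / 9 * ((T : ℝ) + n) / n)) =
        Real.exp (-(10 / 9 * (T / n))) * Real.exp (-(10 / 9)) := by
      rw [← Real.exp_add]
      congr 1
      field_simp
      ring
    have h2 : (n : ℝ) ^ (7 / 9 : ℝ) = (n : ℝ) ^ (8 / 9 : ℝ) * (n : ℝ) ^ (-1 / 9 : ℝ) := by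
      rw [← Real.rpow_add hn0]
      norm_num
    rw [h1, h2, hκ]
    calc _ = (n : ℝ) ^ (8 / 9 : ℝ) / 2 * ((n : ℝ) ^ (-1 / 9 : ℝ) * Real.exp (-(10 / 9))) := by
          ring
      _ ≤ _ := by
          gcongr
          exact rpow_le_exp_neg (by lia) hT
  have hbad := (systemLaw_real_card_unmet_lt_le G hd hG hV T (by positivity) (by positivity)
    (by positivity) (rpow_le_mul_one_sub_pow hn10 hT) hb ha).trans
    ((error_le (by lia) hT hκ0).trans hε')
  rw [sub_le_comm, ← probReal_compl_eq_one_sub .of_discrete]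
  refine (measureReal_mono fun ω hω => ?_).trans hbad
  simp only [Set.mem_compl_iff, Set.mem_ofPred_eq, not_le] at hω ⊢
  have hcard : (unmet (fun j => moves ω.2 j T) ω.1).card ≤ {i | IsLonely ω i}.ncard := by
    rw [← Set.ncard_coe_finset]
    exact Set.ncard_le_ncard fun i hi => isLonely_of_mem_unmet ω i hi
  calc ((unmet (fun j => moves ω.2 j T) ω.1).card : ℝ) ≤ ({i | IsLonely ω i}.ncard : ℝ) := by
        exact_mod_cast hcard
    _ < κ / 2 * (n : ℝ) ^ (3 / 4 : ℝ) := hω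
    _ ≤ κ / 2 * (n : ℝ) ^ (7 / 9 : ℝ) := by
        exact mul_le_mul_of_nonneg_left
          (Real.rpow_le_rpow_of_exponent_le hn1 (by norm_num)) (by positivity)
    _ = κ * (n : ℝ) ^ (7 / 9 : ℝ) / 2 := by ring
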